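/- **Setting.** Let $d\ge 1$, let $\mathcal X\subseteq\mathbb R^d$ with the Euclidean norm, and let $f$ be a probability density on $\mathbb R^d$ (with respect to Lebesgue measure) that vanishes outside $\mathcal X$. Let $B(x,r)$ be the closed ball of radius $r$ around $x$ and $v_d$ the volume of the unit ball. For $Z\subseteq\mathbb R^d$ and $\sigma>0$ let $Z_\sigma=\{y:\inf_{z\in Z}\|y-z\|\le\sigma\}$. Connected means path-connected (and non-empty). *Separation.* Sets $A,A'\subseteq\mathcal X$ are $(\sigma,\epsilon)$-separated if there is $S\subseteq\mathcal X$ such that (i) every path in $\mathcal X$ from a point of $A$ to a point of $A'$ meets $S$, and (ii) $\sup_{S_\sigma} f<(1-\epsilon)\inf_{A_\sigma\cup A'_\sigma} f$ (the supremum over the empty set being $0$). Say that $\mathcal X$ has no gaps at scale $\sigma$ if any $x,y\in\mathcal X$ with $\|x-y\|\le\sigma$ can be joined by a path in $\mathcal X\cap(B(x,\sigma/2)\cup B(y,\sigma/2))$; this holds for every $\sigma$ if $\mathcal X$ is convex, in particular if $\mathcal X=\mathbb R^d$. *Algorithm (robust single linkage).* Given $X_n=\{x_1,\dots,x_n\}$,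 an integer $k\ge1$ and $\alpha$, let $r_k(x_i)$ be the least $r$ such that $B(x_i,r)$ contains at least $k$ data points. For $r\ge 0$, the graph $G_r$ has the nodes $\{x_i: r_k(x_i)\le r\}$ and an edge between any two distinct nodes with $\|x_i-x_j\|\le\alpha r$. **Theorem.** There are absolute constants $C,C_0>0$ such that the following holds for all $d$, $\mathcal X$, $f$ as above. Let $0<\delta,\epsilon<1$, let $X_n$ consist of $n$ independent draws from $f$, and let $$\sqrt2\le\alpha\le2,\qquad k\ \ge\ C\cdot\frac{d\log n}{\epsilon^2}\cdot\log^2\frac2\delta .$$ Then there is a mapping $r:[0,\infty)\to[0,\infty)$, given for $\lambda>0$ by $$v_d\,r(\lambda)^d\,\lambda=\frac kn+\frac{C_\delta}{n}\sqrt{k\,d\log n},\qquad C_\delta=C_0\log\frac2\delta ,$$ such that with probability at least $1-\delta$ the following holds simultaneously for all connected $A,A'\subseteq\mathcal X$ and all $\sigma>0$ such that $\mathcal X$ has no gaps at scale $\sigma$ and $A,A'$ are $(\sigma,\epsilon)$-separated. Let $\lambda=\inf_{A_\sigma\cup A'_\sigma}f$. If $$n\ \ge\ \frac{k}{v_d(\sigma/2)^d\lambda}\Bigl(1+\frac\epsilon2\Bigr),$$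 then: 1. *Separation.* $A\cap X_n$ is disconnected from $A'\cap X_n$ in $G_{r(\lambda)}$, that is, no path of the graph leads from a point of the one to a point of the other. 2. *Connectedness.* $A\cap X_n$ and $A'\cap X_n$ are each connected in $G_{r(\lambda)}$, that is, all points of $A\cap X_n$ are nodes of $G_{r(\lambda)}$ and lie in one connected component, and likewise for $A'\cap X_n$. -/

import Mathlib

open MeasureTheory
open scoped ENNReal

noncomputable section

namespace ClusterTree

/-- `d`-dimensional Euclidean space. -/
abbrev E (d : ℕ) : Type := EuclideanSpace ℝ (Fin d)

/-- The volume `v_d` of the unit ball of `ℝ^d`. -/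
def unitBallVol (d : ℕ) : ℝ := (volume (Metric.closedBall (0 : E d) 1)).toReal

/-- `f` is a probability density on `ℝ^d` (with respect to Lebesgue measure) that vanishes
outside `𝒳`. -/
structure IsDensityOn {d : ℕ} (f : E d → ℝ) (𝒳 : Set (E d)) : Prop where
  measurable : Measurable f
  nonneg : ∀ x, 0 ≤ f x
  zero_outside : ∀ x, x ∉ 𝒳 → f x = 0
  lintegral_eq_one : ∫⁻ x, ENNReal.ofReal (f x) = 1

/-- The law of a sample `x₁, …, xₙ` of `n` independent draws from the density `f`. -/
def sampleLaw {d : ℕ} (f : E d → ℝ) (n : ℕ) : Measure (Fin n → E d) :=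
  Measure.pi fun _ => volume.withDensity fun x => ENNReal.ofReal (f x)

/-! ### Robust single linkage -/

/-- `r_k(x_i)`, the least radius `r` such that the closed ball `B(x_i, r)` contains at least `k`
of the `n` data points (`x_i` itself included); `∞` if there is none, that is, if `k > n`. -/
def kRadius {d n : ℕ} (x : Fin n → E d) (k : ℕ) (i : Fin n) : ℝ≥0∞ :=
  sInf {ρ : ℝ≥0∞ | k ≤ Set.ncard {j : Fin n | edist (x j) (x i) ≤ ρ}}

/-- The nodes of `G_r`: the data points with `r_k(x_i) ≤ r`. -/
def nodes {d n : ℕ} (x : Fin n → E d) (k : ℕ) (r : ℝ) : Set (Fin n) :=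
  {i | kRadius x k i ≤ ENNReal.ofReal r}

/-- The graph `G_r`: two distinct nodes are adjacent if they are within distance `α r`. -/
def linkGraph {d n : ℕ} (x : Fin n → E d) (k : ℕ) (α r : ℝ) : SimpleGraph (nodes x k r) where
  Adj i j := i ≠ j ∧ dist (x i) (x j) ≤ α * r
  symm := ⟨fun _ _ h => ⟨h.1.symm, by rw [dist_comm]; exact h.2⟩⟩
  loopless := ⟨fun _ h => h.1 rfl⟩

/-- `A ∩ X_n` is connected in `G_r`: all data points in `A` are nodes of `G_r`, and any two of
them lie in the same connected component. -/
def ConnectedInGraph {d n : ℕ} (x : Fin n → E d) (k : ℕ) (α r : ℝ) (A : Set (E d)) : Prop :=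
  (∀ i, x i ∈ A → i ∈ nodes x k r) ∧
    ∀ i j : nodes x k r, x i ∈ A → x j ∈ A → (linkGraph x k α r).Reachable i j

/-- `A ∩ X_n` is disconnected from `A' ∩ X_n` in `G_r`: no path of `G_r` leads from a point of
the former to a point of the latter. -/
def DisconnectedInGraph {d n : ℕ} (x : Fin n → E d) (k : ℕ) (α r : ℝ) (A A' : Set (E d)) :
    Prop :=
  ∀ i j : nodes x k r, x i ∈ A → x j ∈ A' → ¬ (linkGraph x k α r).Reachable i j

/-! ### Separation -/

/-- The infimum of `f` over `A_σ ∪ A'_σ`, where `Z_σ` is the set of points at distance at most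
`σ` from `Z`. -/
def level {d : ℕ} (f : E d → ℝ) (σ : ℝ) (A A' : Set (E d)) : ℝ :=
  sInf (f '' (Metric.cthickening σ A ∪ Metric.cthickening σ A'))

/-- `A` and `A'` are `(σ, ε)`-separated (for the density `f` on `𝒳`). Boundedness of `f` on `S_σ`
says that the supremum is finite; over the empty set the supremum is `0`. -/
def Separated {d : ℕ} (f : E d → ℝ) (𝒳 : Set (E d)) (σ ε : ℝ) (A A' : Set (E d)) : Prop :=
  ∃ S : Set (E d), S ⊆ 𝒳 ∧
    (∀ a ∈ A, ∀ a' ∈ A', ∀ γ : Path a a', (∀ t, γ t ∈ 𝒳) → ∃ t, γ t ∈ S) ∧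
    BddAbove (f '' Metric.cthickening σ S) ∧
    sSup (f '' Metric.cthickening σ S) < (1 - ε) * level f σ A A'

/-- `𝒳` has no gaps at scale `σ`: points of `𝒳` within distance `σ` of each other are joined by
a path in `𝒳` all of whose points are within `σ / 2` of one of the two. Every convex set has this
property for every `σ`. -/
def NoGaps {d : ℕ} (𝒳 : Set (E d)) (σ : ℝ) : Prop :=
  ∀ x ∈ 𝒳, ∀ y ∈ 𝒳, dist x y ≤ σ →
    JoinedIn (𝒳 ∩ (Metric.closedBall x (σ / 2) ∪ Metric.closedBall y (σ / 2))) x y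

end ClusterTree

end

/-!
A sample is representative if every ball around a sample point contains about as many sample points
as its mass predicts, up to the deviation `C_δ √(k d log n)`. For a fixed centre the balls are
nested, so one Chernoff bound serves all radii, and a union bound over the `n` centres is enough.

Separation: a node of `G_r` near `S` would have `k` sample points in a ball whose mass is too small.
A path of `G_r` from `A` to `A'` therefore has all its nodes far from `S`, and since `𝒳` has no gaps
it can be followed by a path in `𝒳` that avoids `S`.

Connectedness: the open `r`-balls around the sample points of one component of `G_r` cover `A`. At
a point `y` on the boundary of the ball around `x_i`, the half ball around `y` which faces `x_i`
has mass at least `k / (4 n)`, so it contains a sample point, which is within `√2 r` of `x_i` and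
closer to `y` than `r`. To have this for all `y` and `r` at once, the half balls are replaced by
the regions `{z | ‖z‖ ≤ √2 r ∧ ‖z‖ ^ 2 ≤ 2 r (⟪z, v⟫ - η ‖z‖)}`, `z` being the displacement from
`x_i`: they increase with `r`, and a finite grid of directions `v` suffices.
-/

noncomputable section

namespace ClusterTree

open ProbabilityTheory

section Quantile

lemma measure_setOf_measure_Iic_le {α : Type*} [LinearOrder α] [TopologicalSpace α]
    [OrderTopology α] [SecondCountableTopology α] [MeasurableSpace α] [BorelSpace α]
    (ν : Measure α) [ν.InnerRegular] (p : ℝ≥0∞) :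
    ν {t | ν (Set.Iic t) ≤ p} ≤ p := by
  have hmeas : MeasurableSet {t | ν (Set.Iic t) ≤ p} :=
    (IsLowerSet.ordConnected fun _ _ hba ha =>
      (measure_mono (Set.Iic_subset_Iic.2 hba)).trans ha).measurableSet
  rw [hmeas.measure_eq_iSup_isCompact]
  refine iSup₂_le fun K hK => iSup_le fun hKc => ?_
  rcases K.eq_empty_or_nonempty with rfl | hne
  · simp
  · obtain ⟨t, htK, ht⟩ := hKc.exists_isGreatest hne
    exact (measure_mono ht).trans (hK htK)

variable {Ω : Type*} [MeasurableSpace Ω] (μ : Measure Ω) {g : Ω → ℝ}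

lemma measure_setOf_measure_le_le [IsFiniteMeasure μ] (hg : Measurable g) (p : ℝ≥0∞) :
    μ {z | μ {w | g w ≤ g z} ≤ p} ≤ p := by
  calc μ {z | μ {w | g w ≤ g z} ≤ p} = μ (g ⁻¹' {t | μ.map g (Set.Iic t) ≤ p}) := by
        simp only [Measure.map_apply hg measurableSet_Iic]
        rfl
    _ ≤ μ.map g {t | μ.map g (Set.Iic t) ≤ p} := Measure.le_map_apply hg.aemeasurable _
    _ ≤ p := measure_setOf_measure_Iic_le _ p

lemma le_measure_setOf_measure_lt_lt [IsProbabilityMeasure μ] (hg : Measurable g) {p : ℝ≥0∞}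
    (hp : p ≤ 1) : p ≤ μ {z | μ {w | g w < g z} < p} := by
  have hcompl : {z | μ {w | g w < g z} < p}ᶜ ⊆ {z | μ {w | -g w ≤ -g z} ≤ 1 - p} := by
    intro z hz
    have hlt : {w | -g w ≤ -g z} = {w | g w < g z}ᶜ := by ext; simp
    rw [Set.mem_ofPred_eq, hlt, prob_compl_eq_one_sub (measurableSet_lt hg measurable_const)]
    exact tsub_le_tsub_left (not_lt.1 (show ¬μ {w | g w < g z} < p from hz)) 1
  have hle : μ {z | μ {w | g w < g z} < p}ᶜ ≤ 1 - p :=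
    (measure_mono hcompl).trans (measure_setOf_measure_le_le μ hg.neg _)
  calc p = 1 - (1 - p) := (ENNReal.sub_sub_cancel ENNReal.one_ne_top hp).symm
    _ ≤ 1 - μ {z | μ {w | g w < g z} < p}ᶜ := tsub_le_tsub_left hle 1
    _ ≤ μ {z | μ {w | g w < g z} < p} := by
        rw [tsub_le_iff_right, ← measure_univ (μ := μ), ← Set.union_compl_self _]
        exact measure_union_le _ _

end Quantile

section Chernoff

lemma exp_mul_ncard_setOf {ι : Type*} [Fintype ι] (P : ι → Prop) [DecidablePred P] (θ : ℝ) :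
    Real.exp (θ * Set.ncard {j | P j}) = ∏ j, if P j then Real.exp θ else 1 := by
  rw [Set.ncard_eq_toFinset_card', Set.toFinset_ofPred, mul_comm, Real.exp_nat_mul,
    ← Finset.prod_const, Finset.prod_filter]

lemma measurable_ncard_setOf {β ι : Type*} [MeasurableSpace β] [Finite ι] {P : ι → β → Prop}
    (hP : ∀ j, MeasurableSet {y | P j y}) :
    Measurable fun y => (Set.ncard {j | P j y} : ℝ) := by
  classical
  cases nonempty_fintype ι
  have hsum : (fun y => (Set.ncard {j | P j y} : ℝ)) = fun y => ∑ j, if P j y then 1 else 0 := by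
    ext y
    rw [Finset.sum_boole, Set.ncard_eq_toFinset_card', Set.toFinset_ofPred]
  rw [hsum]
  exact Finset.measurable_sum _ fun j _ => Measurable.ite (hP j) measurable_const measurable_const

variable {Ω ι : Type*} [MeasurableSpace Ω] [Fintype ι] (μ : Measure Ω) [IsProbabilityMeasure μ]
  {S : Set Ω}

lemma integrable_exp_mul_ncard (hS : MeasurableSet S) (θ : ℝ) :
    Integrable (fun z : ι → Ω => Real.exp (θ * Set.ncard {j | z j ∈ S}))
      (Measure.pi fun _ => μ) := by
  have hmeas : Measurable fun z : ι → Ω => (Set.ncard {j | z j ∈ S} : ℝ) :=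
    measurable_ncard_setOf fun j => measurable_pi_apply j hS
  refine integrable_exp_mul_of_mem_Icc (a := 0) (b := Nat.card ι) hmeas.aemeasurable
    (Filter.Eventually.of_forall fun z => ⟨by positivity, ?_⟩)
  exact_mod_cast Set.ncard_le_card {j | z j ∈ S}

lemma mgf_ncard_eq (hS : MeasurableSet S) (θ : ℝ) :
    mgf (fun z : ι → Ω => (Set.ncard {j | z j ∈ S} : ℝ)) (Measure.pi fun _ => μ) θ =
      (1 + μ.real S * (Real.exp θ - 1)) ^ Fintype.card ι := by
  classical
  have hone : ∫ y, (if y ∈ S then Real.exp θ else 1) ∂μ = 1 + μ.real S * (Real.exp θ - 1) := by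
    have hind : (fun y => if y ∈ S then Real.exp θ else 1) =
        fun y => 1 + S.indicator (fun _ => Real.exp θ - 1) y := by
      ext y
      by_cases hy : y ∈ S <;> simp [hy]
    rw [hind, integral_add (integrable_const _) ((integrable_const _).indicator hS),
      integral_indicator_const _ hS]
    simp
  simp only [mgf, exp_mul_ncard_setOf]
  rw [integral_fintype_prod_eq_pow fun y => if y ∈ S then Real.exp θ else 1, hone]

lemma mgf_ncard_le (hS : MeasurableSet S) (θ : ℝ) :
    mgf (fun z : ι → Ω => (Set.ncard {j | z j ∈ S} : ℝ)) (Measure.pi fun _ => μ) θ ≤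
      Real.exp (Fintype.card ι * (μ.real S * (Real.exp θ - 1))) := by
  have hbase : 0 ≤ 1 + μ.real S * (Real.exp θ - 1) := by
    nlinarith [measureReal_nonneg (μ := μ) (s := S), measureReal_le_one (μ := μ) (s := S),
      Real.exp_pos θ]
  rw [mgf_ncard_eq μ hS, Real.exp_nat_mul]
  exact pow_le_pow_left₀ hbase (by linarith [Real.add_one_le_exp (μ.real S * (Real.exp θ - 1))]) _

variable {p θ : ℝ} (a : ℝ)

lemma measureReal_ncard_le_le (hS : MeasurableSet S) (hp : 0 ≤ p) (hpS : p ≤ μ.real S)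
    (hθ : 0 ≤ θ) (hθ1 : θ ≤ 1) :
    (Measure.pi fun _ : ι => μ).real {z | (Set.ncard {j | z j ∈ S} : ℝ) ≤ a} ≤
      Real.exp (θ * a - Fintype.card ι * p * (θ - θ ^ 2)) := by
  have hexp : Real.exp (-θ) - 1 ≤ -(θ - θ ^ 2) := by
    have := (abs_le.1 (Real.abs_exp_sub_one_sub_id_le (x := -θ)
      (by rwa [abs_neg, abs_of_nonneg hθ]))).2
    linarith
  have hmass : μ.real S * (Real.exp (-θ) - 1) ≤ -(p * (θ - θ ^ 2)) := by
    nlinarith [mul_le_mul_of_nonneg_left hexp (hp.trans hpS), mul_nonneg hθ (sub_nonneg.2 hθ1)]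
  calc _ ≤ Real.exp (- -θ * a) * mgf (fun z : ι → Ω => (Set.ncard {j | z j ∈ S} : ℝ))
        (Measure.pi fun _ => μ) (-θ) :=
        measure_le_le_exp_mul_mgf a (by linarith) (integrable_exp_mul_ncard μ hS _)
    _ ≤ Real.exp (- -θ * a) * Real.exp (Fintype.card ι * (μ.real S * (Real.exp (-θ) - 1))) := by
        gcongr
        exact mgf_ncard_le μ hS _
    _ ≤ Real.exp (θ * a - Fintype.card ι * p * (θ - θ ^ 2)) := by
        rw [← Real.exp_add, neg_neg, mul_assoc, sub_eq_add_neg (θ * a), ← mul_neg]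
        gcongr

lemma measureReal_le_ncard_le (hS : MeasurableSet S) (hpS : μ.real S ≤ p) (hθ : 0 ≤ θ)
    (hθ1 : θ ≤ 1) :
    (Measure.pi fun _ : ι => μ).real {z | a ≤ (Set.ncard {j | z j ∈ S} : ℝ)} ≤
      Real.exp (Fintype.card ι * p * (θ + θ ^ 2) - θ * a) := by
  have hexp : Real.exp θ - 1 ≤ θ + θ ^ 2 := by
    have := (abs_le.1 (Real.abs_exp_sub_one_sub_id_le (x := θ) (by rwa [abs_of_nonneg hθ]))).2
    linarith
  have hmass : μ.real S * (Real.exp θ - 1) ≤ p * (θ + θ ^ 2) :=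
    mul_le_mul hpS hexp (by linarith [Real.one_le_exp hθ]) (measureReal_nonneg.trans hpS)
  calc _ ≤ Real.exp (-θ * a) * mgf (fun z : ι → Ω => (Set.ncard {j | z j ∈ S} : ℝ))
        (Measure.pi fun _ => μ) θ :=
        measure_ge_le_exp_mul_mgf a hθ (integrable_exp_mul_ncard μ hS _)
    _ ≤ Real.exp (-θ * a) * Real.exp (Fintype.card ι * (μ.real S * (Real.exp θ - 1))) := by
        gcongr
        exact mgf_ncard_le μ hS _
    _ ≤ Real.exp (Fintype.card ι * p * (θ + θ ^ 2) - θ * a) := by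
        rw [← Real.exp_add, neg_mul, neg_add_eq_sub, mul_assoc]
        gcongr

end Chernoff

section Neighbours

lemma ncard_setOf_succAbove {m : ℕ} (i : Fin (m + 1)) (P : Fin (m + 1) → Prop) :
    Set.ncard {j | P (i.succAbove j)} = Set.ncard {j | j ≠ i ∧ P j} := by
  rw [← Set.ncard_image_of_injective _ (Fin.succAbove_right_injective (p := i))]
  congr 1
  ext j
  constructor
  · rintro ⟨l, hl, rfl⟩
    exact ⟨Fin.succAbove_ne i l, hl⟩
  · rintro ⟨hj, hP⟩
    obtain ⟨l, rfl⟩ := Fin.exists_succAbove_eq hj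
    exact ⟨l, hP, rfl⟩

variable {Ω : Type*} [MeasurableSpace Ω] (μ : Measure Ω) [IsProbabilityMeasure μ] {m : ℕ}
  (i : Fin (m + 1))

lemma measure_pi_le_of_forall_slice_le {T : Set (Ω × (Fin m → Ω))} (hT : MeasurableSet T)
    {q : ℝ≥0∞} (h : ∀ y, (Measure.pi fun _ : Fin m => μ) {z | (y, z) ∈ T} ≤ q) :
    (Measure.pi fun _ : Fin (m + 1) => μ) {x | (x i, fun j => x (i.succAbove j)) ∈ T} ≤ q := by
  have hmp := measurePreserving_piFinSuccAbove (fun _ : Fin (m + 1) => μ) i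
  calc (Measure.pi fun _ : Fin (m + 1) => μ) {x | (x i, fun j => x (i.succAbove j)) ∈ T}
      = (μ.prod (Measure.pi fun _ : Fin m => μ)) T := hmp.measure_preimage hT.nullMeasurableSet
    _ = ∫⁻ y, (Measure.pi fun _ : Fin m => μ) (Prod.mk y ⁻¹' T) ∂μ := Measure.prod_apply hT
    _ ≤ ∫⁻ _, q ∂μ := lintegral_mono fun y => h y
    _ = q := by simp

variable {R : Set (Ω × Ω)} {p θ : ℝ} (a : ℝ)

lemma measurable_ncard_slice (hR : MeasurableSet R) :
    Measurable fun y : Ω × (Fin m → Ω) => (Set.ncard {j | (y.1, y.2 j) ∈ R} : ℝ) :=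
  measurable_ncard_setOf fun j =>
    measurable_fst.prodMk ((measurable_pi_apply j).comp measurable_snd) hR

lemma measure_ncard_neighbours_le_le (hR : MeasurableSet R) (hp : 0 ≤ p)
    (hpR : ∀ y, p ≤ μ.real {z | (y, z) ∈ R}) (hθ : 0 ≤ θ) (hθ1 : θ ≤ 1) :
    (Measure.pi fun _ => μ) {x | (Set.ncard {j | j ≠ i ∧ (x i, x j) ∈ R} : ℝ) ≤ a} ≤
      ENNReal.ofReal (Real.exp (θ * a - m * p * (θ - θ ^ 2))) := by
  simp_rw [← ncard_setOf_succAbove i]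
  refine measure_pi_le_of_forall_slice_le μ i
    (measurableSet_le (measurable_ncard_slice hR) measurable_const) fun y => ?_
  rw [← ofReal_measureReal]
  simpa using ENNReal.ofReal_le_ofReal
    (measureReal_ncard_le_le (ι := Fin m) μ a (measurable_prodMk_left hR) hp (hpR y) hθ hθ1)

lemma measure_le_ncard_neighbours_le (hR : MeasurableSet R)
    (hpR : ∀ y, μ.real {z | (y, z) ∈ R} ≤ p) (hθ : 0 ≤ θ) (hθ1 : θ ≤ 1) :
    (Measure.pi fun _ => μ) {x | a ≤ (Set.ncard {j | j ≠ i ∧ (x i, x j) ∈ R} : ℝ)} ≤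
      ENNReal.ofReal (Real.exp (m * p * (θ + θ ^ 2) - θ * a)) := by
  simp_rw [← ncard_setOf_succAbove i]
  refine measure_pi_le_of_forall_slice_le μ i
    (measurableSet_le measurable_const (measurable_ncard_slice hR)) fun y => ?_
  rw [← ofReal_measureReal]
  simpa using ENNReal.ofReal_le_ofReal
    (measureReal_le_ncard_le (ι := Fin m) μ a (measurable_prodMk_left hR) (hpR y) hθ hθ1)

variable {n : ℕ} {G : Ω → Ω → ℝ}

/- A union bound over `t` is avoided: the sublevel sets of `G y` are nested, so all those of mass
at least `p` contain the `p`-quantile set, and one tail bound for that set serves them all. -/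
lemma measure_exists_ncard_sublevel_le_le (hG : Measurable (Function.uncurry G)) (i : Fin n)
    (hp : 0 ≤ p) (hp1 : p ≤ 1) (hθ : 0 ≤ θ) (hθ1 : θ ≤ 1) :
    (Measure.pi fun _ => μ) {x | ∃ t, p ≤ μ.real {w | G (x i) w ≤ t} ∧
        (Set.ncard {j | j ≠ i ∧ G (x i) (x j) ≤ t} : ℝ) ≤ a} ≤
      ENNReal.ofReal (Real.exp (θ * a - (n - 1) * p * (θ - θ ^ 2))) := by
  obtain _ | m := n
  · exact i.elim0
  rw [Nat.cast_succ, add_sub_cancel_right]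
  let R : Set (Ω × Ω) := {y | μ {w | G y.1 w < G y.1 y.2} < ENNReal.ofReal p}
  have hR : MeasurableSet R := by
    have : MeasurableSet {v : (Ω × Ω) × Ω | G v.1.1 v.2 < G v.1.1 v.1.2} :=
      measurableSet_lt (hG.comp (measurable_fst.fst.prodMk measurable_snd)) (hG.comp measurable_fst)
    exact measurableSet_lt (measurable_measure_prodMk_left this) measurable_const
  have hpR : ∀ y, p ≤ μ.real {z | (y, z) ∈ R} := fun y =>
    (ENNReal.ofReal_le_iff_le_toReal (measure_ne_top _ _)).1
      (le_measure_setOf_measure_lt_lt μ (hG.comp measurable_prodMk_left)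
        (ENNReal.ofReal_le_one.2 hp1))
  refine (measure_mono ?_).trans (measure_ncard_neighbours_le_le μ i a hR hp hpR hθ hθ1)
  rintro x ⟨t, hpt, hcount⟩
  have hsub : {j | j ≠ i ∧ (x i, x j) ∈ R} ⊆ {j | j ≠ i ∧ G (x i) (x j) ≤ t} := by
    rintro j ⟨hji, hj⟩
    refine ⟨hji, le_of_not_gt fun htj => not_le_of_gt (show μ _ < _ from hj) ?_⟩
    exact ((ENNReal.ofReal_le_iff_le_toReal (measure_ne_top _ _)).2 hpt).trans
      (measure_mono fun w hw => lt_of_le_of_lt hw htj)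
  exact (Nat.cast_le.2 (Set.ncard_le_ncard hsub)).trans hcount

lemma measure_exists_le_ncard_sublevel_le (hG : Measurable (Function.uncurry G)) (i : Fin n)
    (hp : 0 ≤ p) (hθ : 0 ≤ θ) (hθ1 : θ ≤ 1) :
    (Measure.pi fun _ => μ) {x | ∃ t, μ.real {w | G (x i) w ≤ t} ≤ p ∧
        a ≤ (Set.ncard {j | j ≠ i ∧ G (x i) (x j) ≤ t} : ℝ)} ≤
      ENNReal.ofReal (Real.exp ((n - 1) * p * (θ + θ ^ 2) - θ * a)) := by
  obtain _ | m := n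
  · exact i.elim0
  rw [Nat.cast_succ, add_sub_cancel_right]
  let R : Set (Ω × Ω) := {y | μ {w | G y.1 w ≤ G y.1 y.2} ≤ ENNReal.ofReal p}
  have hR : MeasurableSet R := by
    have : MeasurableSet {v : (Ω × Ω) × Ω | G v.1.1 v.2 ≤ G v.1.1 v.1.2} :=
      measurableSet_le (hG.comp (measurable_fst.fst.prodMk measurable_snd)) (hG.comp measurable_fst)
    exact measurableSet_le (measurable_measure_prodMk_left this) measurable_const
  have hpR : ∀ y, μ.real {z | (y, z) ∈ R} ≤ p := fun y =>
    ENNReal.toReal_le_of_le_ofReal hp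
      (measure_setOf_measure_le_le μ (hG.comp measurable_prodMk_left) _)
  refine (measure_mono ?_).trans (measure_le_ncard_neighbours_le μ i a hR hpR hθ hθ1)
  rintro x ⟨t, htp, hcount⟩
  have hsub : {j | j ≠ i ∧ G (x i) (x j) ≤ t} ⊆ {j | j ≠ i ∧ (x i, x j) ∈ R} := by
    rintro j ⟨hji, hj⟩
    exact ⟨hji, (measure_mono fun w hw => le_trans hw hj).trans
      ((ENNReal.le_ofReal_iff_toReal_le (measure_ne_top _ _) hp).2 htp)⟩
  exact hcount.trans (Nat.cast_le.2 (Set.ncard_le_ncard hsub))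

end Neighbours

section Density

variable {d : ℕ} {f : E d → ℝ} {𝒳 T : Set (E d)} {l : ℝ}

/-- The law on `ℝ^d` with density `f`, that is, the law of a single draw. -/
def densityLaw (f : E d → ℝ) : Measure (E d) :=
  volume.withDensity fun x => ENNReal.ofReal (f x)

lemma IsDensityOn.isProbabilityMeasure (hf : IsDensityOn f 𝒳) :
    IsProbabilityMeasure (densityLaw f) :=
  ⟨by rw [densityLaw, withDensity_apply _ MeasurableSet.univ, Measure.restrict_univ,
    hf.lintegral_eq_one]⟩

lemma IsDensityOn.measure_compl_support (hf : IsDensityOn f 𝒳) : densityLaw f 𝒳ᶜ = 0 := by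
  have hempty : {x | ENNReal.ofReal (f x) ≠ 0} ∩ 𝒳ᶜ = ∅ := by
    ext x
    simpa using not_imp_not.1 fun hx => (hf.zero_outside x hx).not_gt
  rw [densityLaw, withDensity_apply_eq_zero hf.measurable.ennreal_ofReal, hempty, measure_empty]

lemma IsDensityOn.isProbabilityMeasure_sampleLaw (hf : IsDensityOn f 𝒳) (n : ℕ) :
    IsProbabilityMeasure (sampleLaw f n) :=
  have := hf.isProbabilityMeasure
  inferInstanceAs (IsProbabilityMeasure (Measure.pi fun _ : Fin n => densityLaw f))

lemma IsDensityOn.mul_volume_le_densityLaw (hf : IsDensityOn f 𝒳) (hT : MeasurableSet T)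
    (hl : 0 ≤ l) (h : ∀ x ∈ T, l ≤ f x) : l * volume.real T ≤ (densityLaw f).real T := by
  have := hf.isProbabilityMeasure
  have hle : ENNReal.ofReal l * volume T ≤ densityLaw f T := by
    rw [densityLaw, withDensity_apply _ hT, ← setLIntegral_const]
    exact setLIntegral_mono' hT fun x hx => ENNReal.ofReal_le_ofReal (h x hx)
  simpa [measureReal_def, hl] using ENNReal.toReal_mono (measure_ne_top _ _) hle

lemma densityLaw_le_mul_volume (hT : MeasurableSet T) (hfin : volume T ≠ ∞) (hl : 0 ≤ l)
    (h : ∀ x ∈ T, f x ≤ l) : (densityLaw f).real T ≤ l * volume.real T := by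
  have hle : densityLaw f T ≤ ENNReal.ofReal l * volume T := by
    rw [densityLaw, withDensity_apply _ hT, ← setLIntegral_const]
    exact setLIntegral_mono' hT fun x hx => ENNReal.ofReal_le_ofReal (h x hx)
  simpa [measureReal_def, hl] using
    ENNReal.toReal_mono (ENNReal.mul_ne_top ENNReal.ofReal_ne_top hfin) hle

lemma unitBallVol_pos (d : ℕ) : 0 < unitBallVol d :=
  ENNReal.toReal_pos (Metric.measure_closedBall_pos volume _ one_pos).ne'
    measure_closedBall_lt_top.ne

variable {r : ℝ}

lemma volume_real_closedBall (x : E d) (hr : 0 ≤ r) :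
    volume.real (Metric.closedBall x r) = unitBallVol d * r ^ d := by
  rw [measureReal_def, Measure.addHaar_closedBall' volume x hr, ENNReal.toReal_mul,
    ENNReal.toReal_ofReal (by positivity), finrank_euclideanSpace_fin, mul_comm, unitBallVol]

lemma IsDensityOn.mul_le_densityLaw_closedBall (hf : IsDensityOn f 𝒳) (hr : 0 ≤ r) (hl : 0 ≤ l)
    {y : E d} (h : ∀ z ∈ Metric.closedBall y r, l ≤ f z) :
    unitBallVol d * r ^ d * l ≤ (densityLaw f).real (Metric.closedBall y r) := by
  rw [← volume_real_closedBall y hr, mul_comm]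
  exact hf.mul_volume_le_densityLaw Metric.isClosed_closedBall.measurableSet hl h

lemma densityLaw_closedBall_le (hr : 0 ≤ r) (hl : 0 ≤ l) {y : E d}
    (h : ∀ z ∈ Metric.closedBall y r, f z ≤ l) :
    (densityLaw f).real (Metric.closedBall y r) ≤ unitBallVol d * r ^ d * l := by
  rw [← volume_real_closedBall y hr, mul_comm]
  exact densityLaw_le_mul_volume Metric.isClosed_closedBall.measurableSet
    measure_closedBall_lt_top.ne hl h

end Density

section HalfBall

variable {V : Type*} [NormedAddCommGroup V] [InnerProductSpace ℝ V]

/-- The half of the closed ball of radius `ρ` around `y` on which `v` points outwards. -/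
def halfBall (y v : V) (ρ : ℝ) : Set V :=
  {z | dist z y ≤ ρ ∧ 0 ≤ inner ℝ (z - y) v}

lemma halfBall_subset_closedBall (y v : V) (ρ : ℝ) :
    halfBall y v ρ ⊆ Metric.closedBall y ρ :=
  fun _ hz => hz.1

variable [MeasurableSpace V] [BorelSpace V]

lemma measurableSet_halfBall (y v : V) (ρ : ℝ) : MeasurableSet (halfBall y v ρ) := by
  have hball : IsClosed {z : V | dist z y ≤ ρ} := isClosed_le (by fun_prop) (by fun_prop)
  have hhalf : IsClosed {z : V | 0 ≤ inner ℝ (z - y) v} := isClosed_le (by fun_prop) (by fun_prop)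
  exact (hball.inter hhalf).measurableSet

lemma measure_closedBall_le_two_mul_halfBall (μ : Measure V) [μ.IsAddLeftInvariant]
    [μ.IsNegInvariant] (y v : V) (ρ : ℝ) :
    μ (Metric.closedBall y ρ) ≤ 2 * μ (halfBall y v ρ) := by
  let τ : V → V := fun z => y + y - z
  have hτ : ∀ z, τ z - y = -(z - y) := fun z => by simp only [τ]; abel
  have hcover : Metric.closedBall y ρ ⊆ halfBall y v ρ ∪ τ ⁻¹' halfBall y v ρ := by
    intro z hz
    rcases le_total 0 (inner ℝ (z - y) v) with h | h
    · exact Or.inl ⟨hz, h⟩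
    · refine Or.inr ⟨?_, ?_⟩
      · rwa [dist_eq_norm, hτ, norm_neg, ← dist_eq_norm]
      · rwa [hτ, inner_neg_left, neg_nonneg]
  have hreflect : μ (τ ⁻¹' halfBall y v ρ) = μ (halfBall y v ρ) :=
    (Measure.measurePreserving_sub_left μ (y + y)).measure_preimage
      (measurableSet_halfBall y v ρ).nullMeasurableSet
  calc μ (Metric.closedBall y ρ) ≤ μ (halfBall y v ρ) + μ (τ ⁻¹' halfBall y v ρ) :=
        (measure_mono hcover).trans (measure_union_le _ _)
    _ = 2 * μ (halfBall y v ρ) := by rw [hreflect, two_mul]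

variable {d : ℕ}

lemma half_le_one_sub_pow (hd : 1 ≤ d) : (1 / 2 : ℝ) ≤ (1 - 1 / (2 * d)) ^ d := by
  have hd0 : (1 : ℝ) ≤ d := by exact_mod_cast hd
  have hle : 1 / (2 * d : ℝ) ≤ 1 / 2 := one_div_le_one_div_of_le two_pos (by linarith)
  have hbern := one_add_mul_le_pow (a := -(1 / (2 * d : ℝ))) (by linarith) d
  have hd' : (d : ℝ) * -(1 / (2 * d)) = -(1 / 2) := by field_simp
  rw [hd', ← sub_eq_add_neg, ← sub_eq_add_neg] at hbern
  linarith

lemma IsDensityOn.mul_le_densityLaw_halfBall {f : E d → ℝ} {𝒳 : Set (E d)} {l r : ℝ}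
    (hf : IsDensityOn f 𝒳) (hd : 1 ≤ d) (hr : 0 ≤ r) (hl : 0 ≤ l) {y : E d}
    (h : ∀ z ∈ Metric.closedBall y r, l ≤ f z) (v : E d) :
    unitBallVol d * r ^ d * l / 4 ≤
      (densityLaw f).real (halfBall y v ((1 - 1 / (2 * d)) * r)) := by
  set η : ℝ := 1 - 1 / (2 * d)
  have hd0 : (1 : ℝ) ≤ d := by exact_mod_cast hd
  have hη : 0 ≤ η := by
    have : 1 / (2 * d : ℝ) ≤ 1 := (div_le_one (by linarith)).2 (by linarith)
    linarith
  have hη1 : η * r ≤ r := mul_le_of_le_one_left hr (sub_le_self 1 (by positivity))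
  have hsub : halfBall y v (η * r) ⊆ Metric.closedBall y r :=
    (halfBall_subset_closedBall y v _).trans (Metric.closedBall_subset_closedBall hη1)
  have hvol : unitBallVol d * (η * r) ^ d ≤ 2 * volume.real (halfBall y v (η * r)) := by
    rw [← volume_real_closedBall y (mul_nonneg hη hr)]
    simpa [measureReal_def] using ENNReal.toReal_mono
      (ENNReal.mul_ne_top ENNReal.ofNat_ne_top (measure_ne_top_of_subset hsub
        measure_closedBall_lt_top.ne))
      (measure_closedBall_le_two_mul_halfBall volume y v (η * r))
  calc unitBallVol d * r ^ d * l / 4 = unitBallVol d * (1 / 2 * r ^ d) / 2 * l := by ring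
    _ ≤ unitBallVol d * (η ^ d * r ^ d) / 2 * l := by
        have := (unitBallVol_pos d).le
        gcongr
        exact half_le_one_sub_pow hd
    _ ≤ l * volume.real (halfBall y v (η * r)) := by
        rw [← mul_pow, mul_comm l]
        gcongr
        linarith
    _ ≤ (densityLaw f).real (halfBall y v (η * r)) :=
        hf.mul_volume_le_densityLaw (measurableSet_halfBall _ _ _) hl fun z hz => h z (hsub hz)

end HalfBall

section Nodes

lemma mem_nodes_iff {d n : ℕ} (x : Fin n → E d) (k : ℕ) {r : ℝ} (hr : 0 ≤ r) (i : Fin n) :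
    i ∈ nodes x k r ↔ k ≤ Set.ncard {j : Fin n | dist (x j) (x i) ≤ r} := by
  have hset : {j : Fin n | dist (x j) (x i) ≤ r} = {j | edist (x j) (x i) ≤ ENNReal.ofReal r} := by
    ext j
    simp only [Set.mem_ofPred_eq, edist_dist]
    exact (ENNReal.ofReal_le_ofReal_iff hr).symm
  rw [hset]
  refine ⟨fun h => ?_, fun h => (sInf_le h : kRadius x k i ≤ _)⟩
  set c := ENNReal.ofReal r
  have hright : ∀ᶠ b in nhdsWithin c (Set.Ioi c),
      ∀ j, edist (x j) (x i) ≤ b → edist (x j) (x i) ≤ c := by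
    refine Filter.eventually_all.2 fun j => ?_
    rcases le_or_gt (edist (x j) (x i)) c with hj | hj
    · exact Filter.Eventually.of_forall fun _ _ => hj
    · filter_upwards [Ioo_mem_nhdsGT hj] with b hb hjb using absurd hjb hb.2.not_ge
  have : (nhdsWithin c (Set.Ioi c)).NeBot := ENNReal.nhdsGT_coe_neBot
  obtain ⟨b, hb, hcb⟩ := (hright.and self_mem_nhdsWithin).exists
  obtain ⟨ρ, hρ, hρb⟩ := sInf_lt_iff.1 (lt_of_le_of_lt (show kRadius x k i ≤ c from h) hcb)
  exact le_trans hρ (Set.ncard_le_ncard fun j hj => hb j (le_trans hj hρb.le))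

end Nodes

section Level

variable {d : ℕ} {f : E d → ℝ} {𝒳 A A' : Set (E d)} {σ ε : ℝ}

lemma level_comm (f : E d → ℝ) (σ : ℝ) (A A' : Set (E d)) : level f σ A A' = level f σ A' A := by
  rw [level, level, Set.union_comm]

lemma IsDensityOn.level_le (hf : IsDensityOn f 𝒳) {y : E d} (hy : y ∈ Metric.cthickening σ A) :
    level f σ A A' ≤ f y :=
  csInf_le ⟨0, by rintro _ ⟨z, -, rfl⟩; exact hf.nonneg z⟩ ⟨y, Or.inl hy, rfl⟩

lemma Separated.level_pos (hf : IsDensityOn f 𝒳) (hε : ε < 1) (h : Separated f 𝒳 σ ε A A') :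
    0 < level f σ A A' := by
  obtain ⟨S, -, -, -, hlt⟩ := h
  have hsup : 0 ≤ sSup (f '' Metric.cthickening σ S) :=
    Real.sSup_nonneg (by rintro _ ⟨z, -, rfl⟩; exact hf.nonneg z)
  exact pos_of_mul_pos_right (hsup.trans_lt hlt) (sub_nonneg.2 hε.le)

lemma IsDensityOn.mul_level_le_one (hf : IsDensityOn f 𝒳) {r : ℝ} (hr : 0 ≤ r) (hrσ : r ≤ σ)
    (hl : 0 < level f σ A A') : unitBallVol d * r ^ d * level f σ A A' ≤ 1 := by
  wlog hA : A.Nonempty generalizing A A'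
  · have hA' : A'.Nonempty := by
      by_contra hA'
      rw [Set.not_nonempty_iff_eq_empty] at hA hA'
      simp [level, hA, hA'] at hl
    rw [level_comm] at hl ⊢
    exact this hl hA'
  obtain ⟨a, ha⟩ := hA
  have := hf.isProbabilityMeasure
  have hball : Metric.closedBall a r ⊆ Metric.cthickening σ A :=
    (Metric.closedBall_subset_closedBall hrσ).trans (Metric.closedBall_subset_cthickening ha σ)
  exact (hf.mul_le_densityLaw_closedBall hr hl.le fun z hz => hf.level_le (hball hz)).trans
    measureReal_le_one

end Level

section Lens

variable {V : Type*} [NormedAddCommGroup V] [InnerProductSpace ℝ V]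

/-- A gauge for the lens-shaped regions
`{z ≠ 0 | ‖z‖ ≤ √2 r ∧ ‖z‖ ^ 2 ≤ 2 r (⟪z, v⟫ - η ‖z‖)}`, which increase with `r`: they are the
sublevel sets of the gauge. The parameter `-1 / r` in place of `r` excludes `z = 0`, where the
divisions make the gauge `0`. -/
def lensGauge (η : ℝ) (v z : V) : ℝ :=
  max (-(√2 / ‖z‖)) (2 * (η * ‖z‖ - inner ℝ z v) / ‖z‖ ^ 2)

lemma measurable_lensGauge [MeasurableSpace V] [BorelSpace V] (η : ℝ) (v : V) :
    Measurable (lensGauge η v) := by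
  have hinner : Measurable fun z : V => inner ℝ z v := by fun_prop
  exact (measurable_const.div measurable_norm).neg.max
    ((((measurable_norm.const_mul η).sub hinner).const_mul 2).div (measurable_norm.pow_const 2))

variable {η r : ℝ} {u v z : V}

lemma lensGauge_le_iff (hr : 0 < r) :
    lensGauge η v z ≤ -(1 / r) ↔
      z ≠ 0 ∧ ‖z‖ ≤ √2 * r ∧ ‖z‖ ^ 2 ≤ 2 * r * (inner ℝ z v - η * ‖z‖) := by
  rcases eq_or_ne z 0 with rfl | hz
  · simpa [lensGauge] using hr
  · have hz0 : 0 < ‖z‖ := norm_pos_iff.2 hz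
    have hsq : -(1 / r) * ‖z‖ ^ 2 = -(‖z‖ ^ 2) / r := by ring
    rw [lensGauge, max_le_iff, neg_le_neg_iff, div_le_div_iff₀ hr hz0, one_mul,
      div_le_iff₀ (by positivity), hsq, le_div_iff₀ hr, and_iff_right hz]
    refine and_congr_right fun _ => ⟨fun h => ?_, fun h => ?_⟩ <;> linarith

lemma norm_sub_smul_sq (hu : ‖u‖ = 1) (r : ℝ) :
    ‖z - r • u‖ ^ 2 = ‖z‖ ^ 2 - 2 * r * inner ℝ z u + r ^ 2 := by
  rw [norm_sub_sq_real, inner_smul_right, norm_smul, hu, mul_one, Real.norm_eq_abs, sq_abs,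
    mul_assoc]

lemma norm_sub_smul_lt_of_lensGauge_le (hr : 0 < r) (hu : ‖u‖ = 1) (hv : ‖v - u‖ < η)
    (hz : lensGauge η v z ≤ -(1 / r)) : ‖z - r • u‖ < r := by
  obtain ⟨hz0, -, hsq⟩ := (lensGauge_le_iff hr).1 hz
  have hinner : inner ℝ z v - inner ℝ z u < η * ‖z‖ := by
    rw [← inner_sub_right]
    calc inner ℝ z (v - u) ≤ ‖z‖ * ‖v - u‖ := real_inner_le_norm _ _
      _ < ‖z‖ * η := by gcongr
      _ = η * ‖z‖ := mul_comm _ _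
  refine lt_of_pow_lt_pow_left₀ 2 hr.le ?_
  rw [norm_sub_smul_sq hu]
  nlinarith [mul_lt_mul_of_pos_left hinner hr]

/- On the half ball `2 r ⟪z, u⟫ - ‖z‖ ^ 2` is at least `6 η r ^ 2`, while replacing `u` by `v` and
subtracting the term in `η` costs at most `4 η r ‖z‖ ≤ 6 η r ^ 2`. -/
lemma lensGauge_le_of_mem_halfBall (hr : 0 < r) (hη : 0 < η) (hη1 : 6 * η ≤ 1) (hu : ‖u‖ = 1)
    (hv : ‖v - u‖ ≤ η) (hz : z ∈ halfBall (r • u) (-u) ((1 - 6 * η) * r)) :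
    lensGauge η v z ≤ -(1 / r) := by
  obtain ⟨hball, hhalf⟩ := hz
  rw [dist_eq_norm] at hball
  have hdepth : 6 * η * r ^ 2 ≤ 2 * r * inner ℝ z u - ‖z‖ ^ 2 := by
    have hsq : ‖z - r • u‖ ^ 2 ≤ ((1 - 6 * η) * r) ^ 2 :=
      pow_le_pow_left₀ (norm_nonneg _) hball 2
    have hshrink : ((1 - 6 * η) * r) ^ 2 ≤ (1 - 6 * η) * r ^ 2 := by
      rw [mul_pow]
      exact mul_le_mul_of_nonneg_right (by nlinarith) (sq_nonneg r)
    rw [norm_sub_smul_sq hu] at hsq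
    linarith
  have hside : inner ℝ z u ≤ r := by
    rw [inner_neg_right, inner_sub_left, real_inner_smul_left, real_inner_self_eq_norm_sq,
      hu] at hhalf
    linarith
  have hηr : 0 < η * r ^ 2 := by positivity
  have hnorm : ‖z‖ ≤ √2 * r := by
    refine le_of_sq_le_sq ?_ (by positivity)
    rw [mul_pow, Real.sq_sqrt zero_le_two]
    nlinarith
  have hsqrt : √2 ≤ 3 / 2 := Real.sqrt_le_iff.2 ⟨by norm_num, by norm_num⟩
  have hinner : inner ℝ z u - inner ℝ z v ≤ η * ‖z‖ := by
    rw [← inner_sub_right, mul_comm]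
    exact (real_inner_le_norm _ _).trans (by rw [norm_sub_rev]; gcongr)
  refine (lensGauge_le_iff hr).2 ⟨?_, hnorm, ?_⟩
  · rintro rfl
    simp only [inner_zero_left, norm_zero] at hdepth
    linarith
  · have hcost : η * ‖z‖ ≤ η * (3 / 2 * r) := by
      gcongr
      exact hnorm.trans (by gcongr)
    nlinarith

end Lens

section Grid

variable {d M : ℕ}

/-- The points of the grid of mesh `1 / M` in the cube `[-1, 1]^d`; they serve as finitely many
directions approximating every unit vector. -/
def gridPoint (M : ℕ) (g : Fin d → Fin (2 * M + 1)) : E d :=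
  WithLp.toLp 2 fun l => -1 + (g l : ℝ) / M

lemma exists_abs_grid_sub_le (hM : 0 < M) {a : ℝ} (ha : |a| ≤ 1) :
    ∃ c : Fin (2 * M + 1), |-1 + (c : ℝ) / M - a| ≤ 1 / M := by
  have hM0 : (0 : ℝ) < M := by exact_mod_cast hM
  obtain ⟨ha0, ha1⟩ := abs_le.1 ha
  have hnonneg : 0 ≤ (a + 1) * M := mul_nonneg (by linarith) hM0.le
  have hfloor : ⌊(a + 1) * M⌋₊ ≤ 2 * M := by
    refine Nat.floor_le_of_le ?_
    push_cast
    gcongr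
    linarith
  refine ⟨⟨⌊(a + 1) * M⌋₊, Nat.lt_succ_of_le hfloor⟩, ?_⟩
  have hrw : -1 + (⌊(a + 1) * M⌋₊ : ℝ) / M - a = (⌊(a + 1) * M⌋₊ - (a + 1) * M) / M := by
    field_simp
    ring
  rw [hrw, abs_div, abs_of_pos hM0]
  gcongr
  rw [abs_le]
  constructor <;> linarith [Nat.floor_le hnonneg, Nat.lt_floor_add_one ((a + 1) * M)]

lemma exists_norm_gridPoint_sub_le (hM : 0 < M) {u : E d} (hu : ‖u‖ ≤ 1) :
    ∃ g, ‖gridPoint M g - u‖ ≤ √d / M := by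
  choose g hg using fun l => exists_abs_grid_sub_le hM ((PiLp.norm_apply_le u l).trans hu)
  refine ⟨g, ?_⟩
  have hsq : ‖gridPoint M g - u‖ ^ 2 ≤ d * (1 / M) ^ 2 := by
    rw [EuclideanSpace.norm_sq_eq]
    refine (Finset.sum_le_card_nsmul _ _ ((1 / (M : ℝ)) ^ 2) fun l _ =>
      pow_le_pow_left₀ (norm_nonneg _) (hg l) 2).trans_eq ?_
    simp
  refine le_of_sq_le_sq (hsq.trans_eq ?_) (by positivity)
  rw [div_pow, div_pow, Real.sq_sqrt (Nat.cast_nonneg d), one_pow, mul_one_div]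

lemma exists_norm_gridPoint_sub_lt (hd : 1 ≤ d) {u : E d} (hu : ‖u‖ ≤ 1) :
    ∃ g, ‖gridPoint (13 * d ^ 2) g - u‖ < 1 / (12 * d) := by
  have hd0 : (1 : ℝ) ≤ d := by exact_mod_cast hd
  obtain ⟨g, hg⟩ := exists_norm_gridPoint_sub_le (M := 13 * d ^ 2) (by positivity) hu
  refine ⟨g, hg.trans_lt ?_⟩
  have hsqrt : √(d : ℝ) ≤ d := Real.sqrt_le_self_iff.2 (Or.inr hd0)
  push_cast
  rw [div_lt_div_iff₀ (by positivity) (by positivity)]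
  nlinarith

end Grid

section Graph

variable {d n k : ℕ} {𝒳 S A A' : Set (E d)} {σ α r : ℝ} {x : Fin n → E d}

lemma reachable_linkGraph_of_dist_le {i j : nodes x k r} (h : dist (x i) (x j) ≤ α * r) :
    (linkGraph x k α r).Reachable i j := by
  rcases eq_or_ne i j with rfl | hij
  · exact SimpleGraph.Reachable.refl i
  · exact SimpleGraph.Adj.reachable ⟨hij, h⟩

lemma joinedIn_diff_of_reachable (hgap : NoGaps 𝒳 σ) (hσ : 0 ≤ σ) (hα : α * r ≤ σ)
    (hx : ∀ i, x i ∈ 𝒳) (hfar : ∀ i ∈ nodes x k r, ∀ s ∈ S, σ / 2 < dist s (x i))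
    {i j : nodes x k r} (h : (linkGraph x k α r).Reachable i j) :
    JoinedIn (𝒳 \ S) (x i) (x j) := by
  obtain ⟨w⟩ := h
  induction w with
  | @nil u =>
    refine JoinedIn.refl ⟨hx u, fun hs => (hfar u u.2 _ hs).not_ge ?_⟩
    rw [dist_self]
    positivity
  | @cons u v _ huv _ ih =>
    refine JoinedIn.trans ?_ ih
    refine (hgap _ (hx u) _ (hx v) (huv.2.trans hα)).mono fun y hy => ⟨hy.1, fun hs => ?_⟩
    rcases hy.2 with h | h
    · exact (hfar u u.2 y hs).not_ge h
    · exact (hfar v v.2 y hs).not_ge h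

lemma disconnectedInGraph_of_forall_lt_dist (hgap : NoGaps 𝒳 σ) (hσ : 0 ≤ σ) (hα : α * r ≤ σ)
    (hx : ∀ i, x i ∈ 𝒳) (hfar : ∀ i ∈ nodes x k r, ∀ s ∈ S, σ / 2 < dist s (x i))
    (hS : ∀ a ∈ A, ∀ a' ∈ A', ∀ γ : Path a a', (∀ t, γ t ∈ 𝒳) → ∃ t, γ t ∈ S) :
    DisconnectedInGraph x k α r A A' := by
  intro i j hi hj hreach
  obtain ⟨γ, hγ⟩ := joinedIn_diff_of_reachable hgap hσ hα hx hfar hreach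
  obtain ⟨t, ht⟩ := hS _ hi _ hj γ fun t => (hγ t).1
  exact (hγ t).2 ht

lemma connectedInGraph_of_isPreconnected (hA : IsPreconnected A) (hα : 1 ≤ α) (hr : 0 < r)
    (hnode : ∀ i, ∀ y ∈ A, dist (x i) y ≤ r → i ∈ nodes x k r)
    (hstep : ∀ i, ∀ y ∈ A, dist (x i) y = r → ∃ j, dist (x i) (x j) ≤ α * r ∧ dist (x j) y < r) :
    ConnectedInGraph x k α r A := by
  refine ⟨fun i hi => hnode i _ hi (by rw [dist_self]; exact hr.le), fun i j hi hj => ?_⟩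
  let C : Set (nodes x k r) := {c | (linkGraph x k α r).Reachable i c}
  let U : Set (E d) := ⋃ c ∈ C, Metric.ball (x c) r
  have hUopen : IsOpen U := isOpen_biUnion fun _ _ => Metric.isOpen_ball
  have hiU : x i ∈ U :=
    Set.mem_biUnion (show i ∈ C from SimpleGraph.Reachable.refl i) (Metric.mem_ball_self hr)
  have hclosure : closure U ⊆ ⋃ c ∈ C, Metric.closedBall (x c) r :=
    closure_minimal (Set.iUnion₂_mono fun _ _ => Metric.ball_subset_closedBall)
      (C.toFinite.isClosed_biUnion fun _ _ => Metric.isClosed_closedBall)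
  have hAU : closure U ∩ A ⊆ U := by
    rintro y ⟨hyU, hyA⟩
    obtain ⟨c, hc, hyc⟩ := Set.mem_iUnion₂.1 (hclosure hyU)
    rcases (Metric.mem_closedBall.1 hyc).lt_or_eq with hlt | heq
    · exact Set.mem_biUnion hc hlt
    · obtain ⟨e, hce, hey⟩ := hstep c y hyA (by rwa [dist_comm])
      have hreach : (linkGraph x k α r).Reachable i ⟨e, hnode e y hyA hey.le⟩ :=
        SimpleGraph.Reachable.trans hc (reachable_linkGraph_of_dist_le hce)
      exact Set.mem_biUnion (show _ ∈ C from hreach) (Metric.mem_ball'.2 hey)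
  obtain ⟨c, hc, hjc⟩ := Set.mem_iUnion₂.1
    (hA.subset_of_closure_inter_subset hUopen ⟨x i, hi, hiU⟩ hAU hj)
  refine SimpleGraph.Reachable.trans hc (reachable_linkGraph_of_dist_le ?_)
  exact (Metric.mem_ball'.1 hjc).le.trans (le_mul_of_one_le_left hr.le hα)

end Graph

section Representative

variable {d n k : ℕ} {f : E d → ℝ} {𝒳 A A' : Set (E d)} {σ ε α s r l : ℝ} {x : Fin n → E d}

/-- A sample in `𝒳` is representative, with deviation `s` from the mean, if every ball around a
sample point whose mass is at least `(k + s) / n` contains `k` sample points, every one whose mass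
is at most `(k - s) / n` does not, and a half ball of mass at least `k / (4 n)` facing a sample
point `x_i` at distance `r` from its centre yields a further sample point near `x_i` and the centre.
Shrinking the half ball by the factor `1 - 1 / (2 d)` leaves room for approximating the direction
`u`, and keeps at least half of its volume. -/
structure IsRepresentative (f : E d → ℝ) (𝒳 : Set (E d)) (k : ℕ) (s : ℝ) (x : Fin n → E d) :
    Prop where
  mem : ∀ i, x i ∈ 𝒳
  lower : ∀ i r, 0 ≤ r → (k + s) / n ≤ (densityLaw f).real (Metric.closedBall (x i) r) →
    k ≤ Set.ncard {j | dist (x j) (x i) ≤ r}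
  upper : ∀ i r, 0 ≤ r → (densityLaw f).real (Metric.closedBall (x i) r) ≤ (k - s) / n →
    Set.ncard {j | dist (x j) (x i) ≤ r} < k
  half : ∀ i r u, 0 < r → ‖u‖ = 1 →
    k / (4 * n) ≤
      (densityLaw f).real (halfBall (x i + r • u) (-u) ((1 - 1 / (2 * d)) * r)) →
    ∃ j, dist (x i) (x j) ≤ √2 * r ∧ dist (x j) (x i + r • u) < r

lemma IsRepresentative.disconnectedInGraph (hx : IsRepresentative f 𝒳 k s x)
    (hf : IsDensityOn f 𝒳) (hgap : NoGaps 𝒳 σ) (hsep : Separated f 𝒳 σ ε A A') (hα : α ≤ 2)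
    (hr : 0 ≤ r) (hrσ : r ≤ σ / 2)
    (hmass : (1 - ε) * (unitBallVol d * r ^ d * level f σ A A') ≤ (k - s) / n) :
    DisconnectedInGraph x k α r A A' := by
  obtain ⟨S, -, hpath, hbdd, hlt⟩ := hsep
  refine disconnectedInGraph_of_forall_lt_dist hgap (by linarith) (by nlinarith) hx.mem
    (fun i hi p hp => lt_of_not_ge fun hclose => ?_) hpath
  have hball : Metric.closedBall (x i) r ⊆ Metric.cthickening σ S :=
    (Metric.closedBall_subset_closedBall' (by rw [dist_comm]; linarith)).trans
      (Metric.closedBall_subset_cthickening hp σ)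
  have hsup : 0 ≤ sSup (f '' Metric.cthickening σ S) :=
    Real.sSup_nonneg (by rintro _ ⟨z, -, rfl⟩; exact hf.nonneg z)
  have hvol : 0 ≤ unitBallVol d * r ^ d := mul_nonneg (unitBallVol_pos d).le (pow_nonneg hr d)
  refine (hx.upper i r hr ?_).not_ge ((mem_nodes_iff x k hr i).1 hi)
  calc (densityLaw f).real (Metric.closedBall (x i) r)
      ≤ unitBallVol d * r ^ d * sSup (f '' Metric.cthickening σ S) :=
        densityLaw_closedBall_le hr hsup fun z hz => le_csSup hbdd ⟨z, hball hz, rfl⟩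
    _ ≤ unitBallVol d * r ^ d * ((1 - ε) * level f σ A A') := by gcongr
    _ = (1 - ε) * (unitBallVol d * r ^ d * level f σ A A') := by ring
    _ ≤ (k - s) / n := hmass

lemma IsRepresentative.connectedInGraph (hx : IsRepresentative f 𝒳 k s x)
    (hf : IsDensityOn f 𝒳) (hd : 1 ≤ d) (hs : 0 ≤ s) (hA : IsPreconnected A) (hα : √2 ≤ α)
    (hl : 0 ≤ l) (hlf : ∀ z ∈ Metric.cthickening σ A, l ≤ f z) (hr : 0 < r) (hrσ : r ≤ σ / 2)
    (hmass : unitBallVol d * r ^ d * l = (k + s) / n) : ConnectedInGraph x k α r A := by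
  have hball : ∀ y ∈ A, ∀ z, dist z y ≤ r → Metric.closedBall z r ⊆ Metric.cthickening σ A :=
    fun y hy z hzy => (Metric.closedBall_subset_closedBall' (by linarith)).trans
      (Metric.closedBall_subset_cthickening hy σ)
  refine connectedInGraph_of_isPreconnected hA
    ((Real.one_le_sqrt.2 one_le_two).trans hα) hr (fun i y hy hiy => ?_) fun i y hy hiy => ?_
  · refine (mem_nodes_iff x k hr.le i).2 (hx.lower i r hr.le ?_)
    rw [← hmass]
    exact hf.mul_le_densityLaw_closedBall hr.le hl fun z hz => hlf z (hball y hy _ hiy hz)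
  · let u : E d := r⁻¹ • (y - x i)
    have hu : ‖u‖ = 1 := by
      rw [norm_smul, norm_inv, Real.norm_of_nonneg hr.le, ← dist_eq_norm, dist_comm, hiy,
        inv_mul_cancel₀ hr.ne']
    have hy_eq : x i + r • u = y := by rw [smul_inv_smul₀ hr.ne', add_sub_cancel]
    have hquarter : (k : ℝ) / (4 * n) ≤ unitBallVol d * r ^ d * l / 4 := by
      rw [hmass, div_div, mul_comm (n : ℝ)]
      gcongr
      linarith
    obtain ⟨j, hij, hjy⟩ := hx.half i r u hr hu (hquarter.trans
      (hf.mul_le_densityLaw_halfBall hd hr.le hl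
        (fun z hz => hlf z (hball y hy _ (by rw [hy_eq, dist_self]; exact hr.le) hz)) _))
    exact ⟨j, hij.trans (by gcongr), hy_eq ▸ hjy⟩

end Representative

section Sampling

variable {d n k : ℕ} {f : E d → ℝ} {𝒳 : Set (E d)} {s δ : ℝ} {x : Fin n → E d}

lemma ncard_setOf_dist_le (x : Fin n → E d) (i : Fin n) {r : ℝ} (hr : 0 ≤ r) :
    Set.ncard {j | dist (x j) (x i) ≤ r} =
      Set.ncard {j | j ≠ i ∧ dist (x j) (x i) ≤ r} + 1 := by
  rw [← Set.ncard_insert_of_notMem (a := i) (by simp) (Set.toFinite _)]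
  congr 1
  ext j
  by_cases h : j = i <;> simp [h, hr]

lemma lower_exponent_le {N κ s : ℝ} (hκ : 0 < κ) (hs : 0 ≤ s) (hsκ : s ≤ κ) (hN : κ + s ≤ N) :
    s / (4 * κ) * (κ - 2) - (N - 1) * ((κ + s) / N) * (s / (4 * κ) - (s / (4 * κ)) ^ 2) ≤
      -(s ^ 2 / (16 * κ)) := by
  have hN0 : 0 < N := by linarith
  obtain ⟨θ, rfl⟩ : ∃ θ, s = 4 * κ * θ := ⟨s / (4 * κ), by field_simp⟩
  have hθ : 4 * κ * θ / (4 * κ) = θ := by field_simp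
  have hgoal : (4 * κ * θ) ^ 2 / (16 * κ) = κ * θ ^ 2 := by field_simp; ring
  have hθ0 : 0 ≤ θ := by rw [← hθ]; positivity
  have hθ1 : 4 * θ ≤ 1 := by nlinarith
  have hmean : κ + 4 * κ * θ - 1 ≤ (N - 1) * ((κ + 4 * κ * θ) / N) := by
    have hsplit : (N - 1) * ((κ + 4 * κ * θ) / N) =
        κ + 4 * κ * θ - (κ + 4 * κ * θ) / N := by field_simp
    rw [hsplit]
    linarith [(div_le_one hN0).2 hN]
  rw [hθ, hgoal]
  have hmul := mul_le_mul_of_nonneg_right hmean (show 0 ≤ θ - θ ^ 2 by nlinarith)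
  nlinarith [mul_nonneg hκ.le (sq_nonneg θ),
    mul_le_mul_of_nonneg_left hθ1 (mul_nonneg hκ.le (sq_nonneg θ))]

lemma upper_exponent_le {N κ s : ℝ} (hN : 0 < N) (hκ : 0 < κ) (hs : 2 ≤ s) (hsκ : s ≤ κ) :
    (N - 1) * ((κ - s) / N) * (s / (4 * κ) + (s / (4 * κ)) ^ 2) - s / (4 * κ) * (κ - 1) ≤
      -(s ^ 2 / (16 * κ)) := by
  obtain ⟨θ, rfl⟩ : ∃ θ, s = 4 * κ * θ := ⟨s / (4 * κ), by field_simp⟩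
  have hθ : 4 * κ * θ / (4 * κ) = θ := by field_simp
  have hgoal : (4 * κ * θ) ^ 2 / (16 * κ) = κ * θ ^ 2 := by field_simp; ring
  have hθ0 : 0 ≤ θ := by rw [← hθ]; exact div_nonneg (by linarith) (by positivity)
  have hmean : (N - 1) * ((κ - 4 * κ * θ) / N) ≤ κ - 4 * κ * θ := by
    have hsplit : (N - 1) * ((κ - 4 * κ * θ) / N) =
        κ - 4 * κ * θ - (κ - 4 * κ * θ) / N := by field_simp
    rw [hsplit]
    linarith [div_nonneg (sub_nonneg.2 hsκ) hN.le]
  rw [hθ, hgoal]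
  have hmul := mul_le_mul_of_nonneg_right hmean (show 0 ≤ θ + θ ^ 2 by positivity)
  nlinarith [mul_nonneg hκ.le (pow_nonneg hθ0 3), mul_le_mul_of_nonneg_left hs hθ0]

lemma IsDensityOn.sampleLaw_notMem (hf : IsDensityOn f 𝒳) (i : Fin n) :
    sampleLaw f n {x | x i ∉ 𝒳} = 0 := by
  have := hf.isProbabilityMeasure
  have heval := measurePreserving_eval (fun _ : Fin n => densityLaw f) i
  exact heval.quasiMeasurePreserving.preimage_null hf.measure_compl_support

lemma IsDensityOn.sampleLaw_exists_ncard_lt (hf : IsDensityOn f 𝒳) (hk : 1 ≤ k) (hs : 0 ≤ s)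
    (hsk : s ≤ k) (hkn : k + s ≤ n) (i : Fin n) :
    sampleLaw f n {x | ∃ r, 0 ≤ r ∧
        (k + s) / n ≤ (densityLaw f).real (Metric.closedBall (x i) r) ∧
        Set.ncard {j | dist (x j) (x i) ≤ r} < k} ≤
      ENNReal.ofReal (Real.exp (-(s ^ 2 / (16 * k)))) := by
  have := hf.isProbabilityMeasure
  have hk0 : (0 : ℝ) < k := by exact_mod_cast hk
  have hθ1 : s / (4 * k) ≤ 1 := (div_le_one (by positivity)).2 (by linarith)
  refine (measure_mono ?_).trans <| (measure_exists_ncard_sublevel_le_le (densityLaw f) (k - 2 : ℝ)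
    (G := fun x w : E d => dist w x) (measurable_snd.dist measurable_fst) i
    (p := (k + s) / n) (by positivity) ((div_le_one (by linarith)).2 hkn)
    (by positivity) hθ1).trans <|
    ENNReal.ofReal_le_ofReal (Real.exp_le_exp.2 (lower_exponent_le hk0 hs hsk hkn))
  rintro x ⟨r, hr, hmass, hcard⟩
  rw [ncard_setOf_dist_le x i hr, Nat.lt_iff_add_one_le] at hcard
  refine ⟨r, hmass, ?_⟩
  rw [le_sub_iff_add_le]
  exact_mod_cast hcard

lemma IsDensityOn.sampleLaw_exists_le_ncard (hf : IsDensityOn f 𝒳) (hs : 2 ≤ s) (hsk : s ≤ k)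
    (i : Fin n) :
    sampleLaw f n {x | ∃ r, 0 ≤ r ∧
        (densityLaw f).real (Metric.closedBall (x i) r) ≤ (k - s) / n ∧
        k ≤ Set.ncard {j | dist (x j) (x i) ≤ r}} ≤
      ENNReal.ofReal (Real.exp (-(s ^ 2 / (16 * k)))) := by
  have := hf.isProbabilityMeasure
  have hk0 : (0 : ℝ) < k := by linarith
  have hn0 : (0 : ℝ) < n := by exact_mod_cast i.pos
  have hθ0 : 0 ≤ s / (4 * k) := div_nonneg (by linarith) (by positivity)
  have hθ1 : s / (4 * k) ≤ 1 := (div_le_one (by positivity)).2 (by linarith)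
  refine (measure_mono ?_).trans <| (measure_exists_le_ncard_sublevel_le (densityLaw f) (k - 1 : ℝ)
    (G := fun x w : E d => dist w x) (measurable_snd.dist measurable_fst) i
    (div_nonneg (sub_nonneg.2 hsk) hn0.le) hθ0 hθ1).trans <|
    ENNReal.ofReal_le_ofReal (Real.exp_le_exp.2 (upper_exponent_le hn0 hk0 hs hsk))
  rintro x ⟨r, hr, hmass, hcard⟩
  rw [ncard_setOf_dist_le x i hr] at hcard
  refine ⟨r, hmass, ?_⟩
  rw [sub_le_iff_le_add]
  exact_mod_cast hcard

lemma IsDensityOn.sampleLaw_exists_lt_lensGauge (hf : IsDensityOn f 𝒳) (hn : 2 ≤ n) (hkn : k ≤ n)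
    (i : Fin n) (η : ℝ) (v : E d) :
    sampleLaw f n {x | ∃ t,
        k / (4 * n) ≤ (densityLaw f).real {w | lensGauge η v (w - x i) ≤ t} ∧
        ∀ j, t < lensGauge η v (x j - x i)} ≤
      ENNReal.ofReal (Real.exp (-(k / 32))) := by
  have := hf.isProbabilityMeasure
  have hn2 : (2 : ℝ) ≤ n := by exact_mod_cast hn
  have hkn' : (k : ℝ) ≤ n := by exact_mod_cast hkn
  have hexp : (1 / 2 : ℝ) * 0 - (n - 1) * (k / (4 * n)) * (1 / 2 - (1 / 2) ^ 2) ≤ -(k / 32) := by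
    have hmean : (k : ℝ) / 8 ≤ (n - 1) * (k / (4 * n)) := by
      rw [← mul_div_assoc, div_le_div_iff₀ (by norm_num) (by positivity)]
      nlinarith [mul_nonneg (Nat.cast_nonneg (α := ℝ) k) (sub_nonneg.2 hn2)]
    linarith
  refine (measure_mono ?_).trans <| (measure_exists_ncard_sublevel_le_le (densityLaw f) 0
    (G := fun x w : E d => lensGauge η v (w - x))
    ((measurable_lensGauge η v).comp (measurable_snd.sub measurable_fst)) i
    (p := k / (4 * n)) (by positivity) ((div_le_one (by positivity)).2 (by linarith))
    (by norm_num) (by norm_num)).trans <| ENNReal.ofReal_le_ofReal (Real.exp_le_exp.2 hexp)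
  rintro x ⟨t, hmass, hlt⟩
  refine ⟨t, hmass, ?_⟩
  simp [(hlt _).not_ge]

lemma exists_dist_lt_of_forall_gridPoint (hd : 1 ≤ d) (μ : Measure (E d)) [IsFiniteMeasure μ]
    {i : Fin n} {a : ℝ}
    (hlens : ∀ (g : Fin d → Fin (2 * (13 * d ^ 2) + 1)) (t : ℝ),
      a ≤ μ.real {w | lensGauge (1 / (12 * d)) (gridPoint (13 * d ^ 2) g) (w - x i) ≤ t} →
      ∃ j, lensGauge (1 / (12 * d)) (gridPoint (13 * d ^ 2) g) (x j - x i) ≤ t)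
    {r : ℝ} {u : E d} (hr : 0 < r) (hu : ‖u‖ = 1)
    (hmass : a ≤ μ.real (halfBall (x i + r • u) (-u) ((1 - 1 / (2 * d)) * r))) :
    ∃ j, dist (x i) (x j) ≤ √2 * r ∧ dist (x j) (x i + r • u) < r := by
  have hd' : (1 : ℝ) ≤ d := by exact_mod_cast hd
  obtain ⟨g, hg⟩ := exists_norm_gridPoint_sub_lt hd hu.le
  have hη : (1 : ℝ) / (2 * d) = 6 * (1 / (12 * d)) := by field_simp; norm_num
  have hη1 : (6 : ℝ) * (1 / (12 * d)) ≤ 1 := by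
    rw [← hη, div_le_one (by positivity)]
    linarith
  obtain ⟨j, hj⟩ := hlens g (-(1 / r)) <| hmass.trans <| measureReal_mono fun w hw => by
    refine lensGauge_le_of_mem_halfBall hr (by positivity) hη1 hu hg.le ?_
    rw [← hη]
    simpa only [halfBall, Set.mem_ofPred_eq, dist_eq_norm, sub_add_eq_sub_sub] using hw
  refine ⟨j, ?_, ?_⟩
  · rw [dist_comm, dist_eq_norm]
    exact ((lensGauge_le_iff hr).1 hj).2.1
  · rw [dist_eq_norm, sub_add_eq_sub_sub]
    exact norm_sub_smul_lt_of_lensGauge_le hr hu hg hj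

lemma measure_iUnion_le_ofReal {Ω ι : Type*} [MeasurableSpace Ω] [Fintype ι] (μ : Measure Ω)
    {N : ι → Set Ω} {q c : ℝ} (hN : ∀ i, μ (N i) ≤ ENNReal.ofReal q)
    (hc : Fintype.card ι * q ≤ c) : μ (⋃ i, N i) ≤ ENNReal.ofReal c := by
  refine (measure_iUnion_fintype_le μ N).trans ((Finset.sum_le_card_nsmul _ _ _ fun i _ =>
    hN i).trans ?_)
  rw [nsmul_eq_mul, Finset.card_univ, ← ENNReal.ofReal_natCast,
    ← ENNReal.ofReal_mul (Nat.cast_nonneg _)]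
  exact ENNReal.ofReal_le_ofReal hc

lemma IsDensityOn.sampleLaw_not_isRepresentative_le (hf : IsDensityOn f 𝒳) (hd : 1 ≤ d)
    (hδ : 0 ≤ δ) (hs : 2 ≤ s) (hsk : s ≤ k) (hkn : k + s ≤ n)
    (htail : n * Real.exp (-(s ^ 2 / (16 * k))) ≤ δ / 4)
    (hgrid : n * (2 * (13 * d ^ 2) + 1) ^ d * Real.exp (-(k / 32)) ≤ δ / 4) :
    sampleLaw f n {x | ¬ IsRepresentative f 𝒳 k s x} ≤ ENNReal.ofReal δ := by
  have hk : 1 ≤ k := by exact_mod_cast (by linarith : (1 : ℝ) ≤ k)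
  have hn : 2 ≤ n := by exact_mod_cast (by linarith : (2 : ℝ) ≤ n)
  have hkn' : k ≤ n := by exact_mod_cast (by linarith : (k : ℝ) ≤ n)
  have hout := measure_iUnion_null fun i : Fin n => hf.sampleLaw_notMem i
  have hlower := measure_iUnion_le_ofReal (c := δ / 4) (sampleLaw f n)
    (fun i : Fin n => hf.sampleLaw_exists_ncard_lt hk (by linarith) hsk hkn i)
    (by rwa [Fintype.card_fin])
  have hupper := measure_iUnion_le_ofReal (c := δ / 4) (sampleLaw f n)
    (fun i : Fin n => hf.sampleLaw_exists_le_ncard hs hsk i) (by rwa [Fintype.card_fin])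
  have hlens := measure_iUnion_le_ofReal (c := δ / 4) (sampleLaw f n)
    (fun p : Fin n × (Fin d → Fin (2 * (13 * d ^ 2) + 1)) =>
      hf.sampleLaw_exists_lt_lensGauge hn hkn' p.1 (1 / (12 * d)) (gridPoint (13 * d ^ 2) p.2))
    (by simpa using hgrid)
  have hsum : (0 : ℝ≥0∞) + ENNReal.ofReal (δ / 4) + ENNReal.ofReal (δ / 4) +
      ENNReal.ofReal (δ / 4) ≤ ENNReal.ofReal δ := by
    rw [zero_add, ← ENNReal.ofReal_add (by linarith) (by linarith),
      ← ENNReal.ofReal_add (by linarith) (by linarith)]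
    exact ENNReal.ofReal_le_ofReal (by linarith)
  refine (measure_mono fun x hx => ?_).trans <| ((measure_union_le _ _).trans <| add_le_add
    ((measure_union_le _ _).trans <| add_le_add ((measure_union_le _ _).trans <|
      add_le_add hout.le hlower) hupper) hlens).trans hsum
  contrapose! hx
  simp only [Set.mem_union, Set.mem_iUnion, Set.mem_ofPred_eq, not_or, not_exists, not_and,
    not_not, not_lt, not_le, Prod.forall, not_forall] at hx ⊢
  have := hf.isProbabilityMeasure
  exact ⟨hx.1.1.1, hx.1.1.2, hx.1.2, fun i r u hr hu hmass =>
    exists_dist_lt_of_forall_gridPoint hd _ (hx.2 i) hr hu hmass⟩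

lemma exists_measurableSet_of_measure_not_le {Ω : Type*} [MeasurableSpace Ω] {μ : Measure Ω}
    [IsProbabilityMeasure μ] {P : Ω → Prop} (hδ : 0 ≤ δ) (h : μ {x | ¬ P x} ≤ ENNReal.ofReal δ) :
    ∃ G, MeasurableSet G ∧ ENNReal.ofReal (1 - δ) ≤ μ G ∧ ∀ x ∈ G, P x := by
  have hmeas := measurableSet_toMeasurable μ {x | ¬ P x}
  refine ⟨(toMeasurable μ {x | ¬ P x})ᶜ, hmeas.compl, ?_, fun x hx => not_not.1 fun hP =>
    hx (subset_toMeasurable _ _ hP)⟩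
  rw [prob_compl_eq_one_sub hmeas, measure_toMeasurable, ENNReal.ofReal_sub _ hδ,
    ENNReal.ofReal_one]
  exact tsub_le_tsub_left h 1

end Sampling

section Deviation

variable {d n k : ℕ} {δ ε a b : ℝ}

lemma le_log_two_div (hδ : 0 < δ) (hδ1 : δ ≤ 1) : 0.69 ≤ Real.log (2 / δ) := by
  have hmono : Real.log 2 ≤ Real.log (2 / δ) :=
    Real.log_le_log two_pos ((le_div_iff₀ hδ).2 (by linarith))
  linarith [Real.log_two_gt_d9]

lemma le_log_natCast (hn : 2 ≤ n) : 0.69 ≤ Real.log n := by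
  have hmono : Real.log 2 ≤ Real.log n := Real.log_le_log two_pos (by exact_mod_cast hn)
  linarith [Real.log_two_gt_d9]

lemma log_natCast_le_mul_log (hd : 1 ≤ d) (n : ℕ) : Real.log n ≤ d * Real.log n :=
  le_mul_of_one_le_left (Real.log_natCast_nonneg n) (by exact_mod_cast hd)

lemma add_le_mul_sq_mul (ha : 0.69 ≤ a) (hb : 0.69 ≤ b) : b + a ≤ 5 * (a ^ 2 * b) := by
  have hb' : 0.476 * b ≤ a ^ 2 * b := mul_le_mul_of_nonneg_right (by nlinarith) (by linarith)
  have ha' : 0.476 * a ≤ a ^ 2 * b := by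
    nlinarith [mul_nonneg (sub_nonneg.2 ha) (sub_nonneg.2 hb)]
  linarith

lemma mul_exp_neg_le_div_four (hδ : 0 < δ) (hδ1 : δ ≤ 1) (ha : 0 < a)
    (h : Real.log a + 2 * Real.log (2 / δ) ≤ b) : a * Real.exp (-b) ≤ δ / 4 := by
  have hlog : Real.log (a * (2 / δ) ^ 2) ≤ b := by
    rwa [Real.log_mul ha.ne' (by positivity), Real.log_pow, Nat.cast_ofNat]
  have hexp : a * (2 / δ) ^ 2 ≤ Real.exp b := (Real.log_le_iff_le_exp (by positivity)).1 hlog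
  calc a * Real.exp (-b) = a / Real.exp b := by rw [Real.exp_neg, div_eq_mul_inv]
    _ ≤ a / (a * (2 / δ) ^ 2) := by gcongr
    _ = δ * δ / 4 := by field_simp; norm_num
    _ ≤ 1 * δ / 4 := by gcongr
    _ = δ / 4 := by rw [one_mul]

/-- The deviation `C_δ √(k d log n)`, with `C₀ = 20`, which is allowed between the number of sample
points in a ball and its mean. -/
def deviation (δ : ℝ) (d n k : ℕ) : ℝ := 20 * Real.log (2 / δ) * √(k * d * Real.log n)

lemma deviation_nonneg (hδ : 0 < δ) (hδ1 : δ ≤ 1) : 0 ≤ deviation δ d n k := by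
  have := le_log_two_div hδ hδ1
  unfold deviation
  positivity

lemma deviation_sq (δ : ℝ) (d n k : ℕ) :
    deviation δ d n k ^ 2 = 400 * k * (Real.log (2 / δ) ^ 2 * (d * Real.log n)) := by
  have := Real.log_natCast_nonneg n
  rw [deviation, mul_pow, Real.sq_sqrt (by positivity)]
  ring

lemma deviation_le (hε : 0 ≤ ε)
    (hk : 1600 * (Real.log (2 / δ) ^ 2 * (d * Real.log n)) ≤ k * ε ^ 2) :
    deviation δ d n k ≤ ε * k / 2 := by
  refine le_of_sq_le_sq ?_ (by positivity)
  rw [deviation_sq]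
  linarith [mul_le_mul_of_nonneg_left hk (Nat.cast_nonneg (α := ℝ) k)]

lemma two_le_deviation (hδ : 0 < δ) (hδ1 : δ ≤ 1) (hd : 1 ≤ d) (hn : 2 ≤ n) (hk : 1 ≤ k) :
    2 ≤ deviation δ d n k := by
  have hL := le_log_two_div hδ hδ1
  have hD := (le_log_natCast hn).trans (log_natCast_le_mul_log hd n)
  have hk' : (1 : ℝ) ≤ k := by exact_mod_cast hk
  refine le_of_sq_le_sq ?_ (deviation_nonneg hδ hδ1)
  rw [deviation_sq]
  nlinarith [add_le_mul_sq_mul hL hD]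

lemma mul_exp_neg_deviation_sq_le (hδ : 0 < δ) (hδ1 : δ ≤ 1) (hd : 1 ≤ d) (hn : 2 ≤ n)
    (hk : 1 ≤ k) : n * Real.exp (-(deviation δ d n k ^ 2 / (16 * k))) ≤ δ / 4 := by
  have hL := le_log_two_div hδ hδ1
  have hlogn := le_log_natCast hn
  have hlog := log_natCast_le_mul_log hd n
  have hsum := add_le_mul_sq_mul hL (hlogn.trans hlog)
  have hexp : deviation δ d n k ^ 2 / (16 * k) =
      25 * (Real.log (2 / δ) ^ 2 * (d * Real.log n)) := by
    rw [deviation_sq]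
    field_simp
    ring
  refine mul_exp_neg_le_div_four hδ hδ1 (by positivity) ?_
  rw [hexp]
  linarith

lemma log_grid_card_le (hn : 2 ≤ n) (hdn : d ≤ n) :
    Real.log (2 * (13 * d ^ 2) + 1) ≤ 7 * Real.log n := by
  have hn' : (2 : ℝ) ≤ n := by exact_mod_cast hn
  have hpow : (2 * (13 * d ^ 2) + 1 : ℝ) ≤ n ^ 7 := by
    have hsq : (d : ℝ) ^ 2 ≤ n ^ 2 := by gcongr
    have hfive : (2 : ℝ) ^ 5 ≤ n ^ 5 := by gcongr
    have hone : (1 : ℝ) ≤ n ^ 2 := one_le_pow₀ (by linarith)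
    calc (2 * (13 * d ^ 2) + 1 : ℝ) ≤ 2 ^ 5 * n ^ 2 := by linarith
      _ ≤ n ^ 5 * n ^ 2 := by gcongr
      _ = n ^ 7 := by ring
  calc Real.log (2 * (13 * d ^ 2) + 1) ≤ Real.log (n ^ 7) := Real.log_le_log (by positivity) hpow
    _ = 7 * Real.log n := by rw [Real.log_pow, Nat.cast_ofNat]

lemma mul_grid_card_mul_exp_neg_le (hδ : 0 < δ) (hδ1 : δ ≤ 1) (hd : 1 ≤ d) (hn : 2 ≤ n)
    (hkn : k ≤ n) (hk : 1600 * (Real.log (2 / δ) ^ 2 * (d * Real.log n)) ≤ k) :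
    n * (2 * (13 * d ^ 2) + 1) ^ d * Real.exp (-(k / 32)) ≤ δ / 4 := by
  have hL := le_log_two_div hδ hδ1
  have hlog := log_natCast_le_mul_log hd n
  have hsum := add_le_mul_sq_mul hL ((le_log_natCast hn).trans hlog)
  have hdn : d ≤ n := by
    have hkn' : (k : ℝ) ≤ n := by exact_mod_cast hkn
    have hd69 : d * 0.69 ≤ d * Real.log n := by gcongr; exact le_log_natCast hn
    exact_mod_cast (by linarith : (d : ℝ) ≤ n)
  have hgrid : d * Real.log (2 * (13 * d ^ 2) + 1) ≤ d * (7 * Real.log n) := by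
    gcongr
    exact log_grid_card_le hn hdn
  refine mul_exp_neg_le_div_four hδ hδ1 (by positivity) ?_
  rw [Real.log_mul (by positivity) (by positivity), Real.log_pow]
  linarith

end Deviation

section Radius

variable {d n k : ℕ} {f : E d → ℝ} {𝒳 A A' : Set (E d)} {δ σ ε s r l c : ℝ}

lemma exists_radius (hd : 1 ≤ d) (hc : 0 ≤ c) :
    ∃ r : ℝ → ℝ, (∀ l, 0 ≤ l → 0 ≤ r l) ∧ ∀ l, 0 < l → unitBallVol d * r l ^ d * l = c := by
  have hv := unitBallVol_pos d
  refine ⟨fun l => (c / (unitBallVol d * l)) ^ (d : ℝ)⁻¹, fun l hl => by positivity,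
    fun l hl => ?_⟩
  rw [Real.rpow_inv_natCast_pow (by positivity) (by omega)]
  field_simp

lemma radius_le_half (hd : 1 ≤ d) (hσ : 0 ≤ σ) (hl : 0 < l) (hn : 0 < n)
    (hmass : unitBallVol d * r ^ d * l = c / n)
    (hc : c ≤ n * (unitBallVol d * (σ / 2) ^ d * l)) : r ≤ σ / 2 := by
  have hle : unitBallVol d * r ^ d * l ≤ unitBallVol d * (σ / 2) ^ d * l := by
    rw [hmass, div_le_iff₀ (by exact_mod_cast hn)]
    linarith
  have hpow := le_of_mul_le_mul_left (le_of_mul_le_mul_right hle hl) (unitBallVol_pos d)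
  exact le_of_pow_le_pow_left₀ (by omega) (by positivity) hpow

lemma IsDensityOn.sample_size_bounds (hf : IsDensityOn f 𝒳) (hk : 1 ≤ k) (hε : 0 < ε)
    (hs : s ≤ ε * k / 2) (hσ : 0 < σ) (hl : 0 < level f σ A A')
    (hn : (k : ℝ) / (unitBallVol d * (σ / 2) ^ d * level f σ A A') * (1 + ε / 2) ≤ n) :
    2 ≤ n ∧ k + s ≤ n ∧ k + s ≤ n * (unitBallVol d * (σ / 2) ^ d * level f σ A A') := by
  have hv := unitBallVol_pos d
  have hk' : (1 : ℝ) ≤ k := by exact_mod_cast hk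
  rw [div_mul_eq_mul_div, div_le_iff₀ (by positivity)] at hn
  have hmass : n * (unitBallVol d * (σ / 2) ^ d * level f σ A A') ≤ n :=
    mul_le_of_le_one_right (Nat.cast_nonneg n)
      (hf.mul_level_le_one (by positivity) (by linarith) hl)
  have hkε : 0 < k * ε := by positivity
  refine ⟨?_, by linarith, by linarith⟩
  exact_mod_cast (by linarith : (1 : ℝ) < n)

lemma IsDensityOn.exists_event_isRepresentative (hf : IsDensityOn f 𝒳) (hd : 1 ≤ d) (hδ : 0 < δ)
    (hδ1 : δ ≤ 1) (hk : 1 ≤ k) (hkC : 1600 * (Real.log (2 / δ) ^ 2 * (d * Real.log n)) ≤ k) :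
    ∃ G : Set (Fin n → E d), MeasurableSet G ∧ ENNReal.ofReal (1 - δ) ≤ sampleLaw f n G ∧
      ∀ x ∈ G, 2 ≤ n → k + deviation δ d n k ≤ n →
        IsRepresentative f 𝒳 k (deviation δ d n k) x := by
  have := hf.isProbabilityMeasure_sampleLaw n
  by_cases h : 2 ≤ n ∧ k + deviation δ d n k ≤ n
  · obtain ⟨hn, hkn⟩ := h
    have hs := two_le_deviation hδ hδ1 hd hn hk
    have hsk : deviation δ d n k ≤ 1 * k / 2 := deviation_le zero_le_one (by simpa using hkC)
    have hkn' : k ≤ n := by exact_mod_cast (by linarith : (k : ℝ) ≤ n)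
    obtain ⟨G, hG, hprob, hrep⟩ := exists_measurableSet_of_measure_not_le hδ.le <|
      hf.sampleLaw_not_isRepresentative_le hd hδ.le hs (by linarith) hkn
        (mul_exp_neg_deviation_sq_le hδ hδ1 hd hn hk)
        (mul_grid_card_mul_exp_neg_le hδ hδ1 hd hn hkn' hkC)
    exact ⟨G, hG, hprob, fun x hx _ _ => hrep x hx⟩
  · refine ⟨Set.univ, MeasurableSet.univ, ?_, fun x _ hn hkn => absurd ⟨hn, hkn⟩ h⟩
    rw [measure_univ, ENNReal.ofReal_le_one]
    linarith

lemma IsRepresentative.disconnectedInGraph_and_connectedInGraph {x : Fin n → E d}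
    (hx : IsRepresentative f 𝒳 k s x) (hf : IsDensityOn f 𝒳) (hd : 1 ≤ d) (hn : 0 < n)
    (hk : 1 ≤ k) (hs0 : 0 ≤ s) (hs : s ≤ ε * k / 2)
    (hl : 0 < level f σ A A') (hr : 0 ≤ r) (hrσ : r ≤ σ / 2)
    (hmass : unitBallVol d * r ^ d * level f σ A A' = (k + s) / n) :
    (∀ α ≤ 2, NoGaps 𝒳 σ → Separated f 𝒳 σ ε A A' → DisconnectedInGraph x k α r A A') ∧
      ∀ α, √2 ≤ α → (IsPreconnected A → ConnectedInGraph x k α r A) ∧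
        (IsPreconnected A' → ConnectedInGraph x k α r A') := by
  have hk' : (0 : ℝ) < k := by exact_mod_cast hk
  have hr0 : 0 < r := hr.lt_of_ne' fun h => by
    have hpos : 0 < (k + s) / (n : ℝ) := by positivity
    rw [← hmass, h, zero_pow (by omega), mul_zero, zero_mul] at hpos
    exact hpos.false
  refine ⟨fun α hα hgap hsep => ?_, fun α hα => ⟨fun hA => ?_, fun hA' => ?_⟩⟩
  · refine hx.disconnectedInGraph hf hgap hsep hα hr hrσ ?_
    rw [hmass, mul_div_assoc']
    gcongr
    nlinarith
  · exact hx.connectedInGraph hf hd hs0 hA hα hl.le (fun z hz => hf.level_le hz) hr0 hrσ hmass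
  · rw [level_comm] at hl hmass
    exact hx.connectedInGraph hf hd hs0 hA' hα hl.le (fun z hz => hf.level_le hz) hr0 hrσ hmass

end Radius

end ClusterTree

end

theorem theorem1_general {d n k : ℕ} {f : ClusterTree.E d → ℝ} {𝒳 : Set (ClusterTree.E d)}
    {δ ε : ℝ} (hf : ClusterTree.IsDensityOn f 𝒳) (hd : 1 ≤ d) (hδ : 0 < δ) (hδ1 : δ ≤ 1)
    (hε : 0 < ε) (hε1 : ε ≤ 1) (hk : 1 ≤ k)
    (hkC : 1600 * (d * Real.log n / ε ^ 2) * Real.log (2 / δ) ^ 2 ≤ k) :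
    ∃ r : ℝ → ℝ, (∀ l, 0 ≤ l → 0 ≤ r l) ∧
      (∀ l, 0 < l → ClusterTree.unitBallVol d * r l ^ d * l =
        k / n + 20 * Real.log (2 / δ) / n * √(k * d * Real.log n)) ∧
      ∃ G : Set (Fin n → ClusterTree.E d), MeasurableSet G ∧
        ENNReal.ofReal (1 - δ) ≤ ClusterTree.sampleLaw f n G ∧
        ∀ x ∈ G, ∀ (A A' : Set (ClusterTree.E d)) (σ : ℝ), 0 < σ →
          0 < ClusterTree.level f σ A A' →
          (k : ℝ) / (ClusterTree.unitBallVol d * (σ / 2) ^ d * ClusterTree.level f σ A A') *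
              (1 + ε / 2) ≤ n →
          (∀ α ≤ 2, ClusterTree.NoGaps 𝒳 σ → ClusterTree.Separated f 𝒳 σ ε A A' →
            ClusterTree.DisconnectedInGraph x k α (r (ClusterTree.level f σ A A')) A A') ∧
          ∀ α, √2 ≤ α →
            (IsPreconnected A →
              ClusterTree.ConnectedInGraph x k α (r (ClusterTree.level f σ A A')) A) ∧
            (IsPreconnected A' →
              ClusterTree.ConnectedInGraph x k α (r (ClusterTree.level f σ A A')) A') := by
  have hkε : 1600 * (Real.log (2 / δ) ^ 2 * (d * Real.log n)) ≤ k * ε ^ 2 := by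
    rw [← div_le_iff₀ (by positivity)]
    exact hkC.trans_eq' (by ring)
  have hs0 := ClusterTree.deviation_nonneg (d := d) (n := n) (k := k) hδ hδ1
  have hs := ClusterTree.deviation_le hε.le hkε
  obtain ⟨r, hr, hmass⟩ := ClusterTree.exists_radius hd
    (c := (k + ClusterTree.deviation δ d n k) / n) (by positivity)
  obtain ⟨G, hG, hprob, hrep⟩ := hf.exists_event_isRepresentative hd hδ hδ1 hk <|
    hkε.trans (mul_le_of_le_one_right (Nat.cast_nonneg k) (pow_le_one₀ hε.le hε1))
  refine ⟨r, hr, fun l hl => ?_, G, hG, hprob, fun x hx A A' σ hσ hl hn => ?_⟩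
  · rw [hmass l hl, ClusterTree.deviation]
    ring
  · obtain ⟨hn2, hkn, hsize⟩ := hf.sample_size_bounds hk hε hs hσ hl hn
    have hrσ := ClusterTree.radius_le_half hd hσ.le hl (by omega) (hmass _ hl) hsize
    exact (hrep x hx hn2 hkn).disconnectedInGraph_and_connectedInGraph hf hd (by omega) hk hs0 hs
      hl (hr _ hl.le) hrσ (hmass _ hl)

theorem theorem1 :
    ∃ C > (0 : ℝ), ∃ C₀ > (0 : ℝ),
      ∀ (d : ℕ), 1 ≤ d →
      ∀ (𝒳 : Set (ClusterTree.E d)) (f : ClusterTree.E d → ℝ), ClusterTree.IsDensityOn f 𝒳 →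
      ∀ δ ε : ℝ, 0 < δ → δ < 1 → 0 < ε → ε < 1 →
      ∀ (n k : ℕ) (α : ℝ), 1 ≤ k → √2 ≤ α → α ≤ 2 →
        C * (d * Real.log n / ε ^ 2) * Real.log (2 / δ) ^ 2 ≤ (k : ℝ) →
      ∃ r : ℝ → ℝ, (∀ l, 0 ≤ l → 0 ≤ r l) ∧
        (∀ l, 0 < l → ClusterTree.unitBallVol d * r l ^ d * l =
          k / n + C₀ * Real.log (2 / δ) / n * √(k * d * Real.log n)) ∧
        ∃ G : Set (Fin n → ClusterTree.E d), MeasurableSet G ∧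
          ENNReal.ofReal (1 - δ) ≤ ClusterTree.sampleLaw f n G ∧
          ∀ x ∈ G, ∀ (A A' : Set (ClusterTree.E d)) (σ : ℝ),
            A ⊆ 𝒳 → A' ⊆ 𝒳 → IsPathConnected A → IsPathConnected A' →
            0 < σ → ClusterTree.NoGaps 𝒳 σ → ClusterTree.Separated f 𝒳 σ ε A A' →
            (k : ℝ) / (ClusterTree.unitBallVol d * (σ / 2) ^ d * ClusterTree.level f σ A A') *
                (1 + ε / 2) ≤ n →
            ClusterTree.DisconnectedInGraph x k α (r (ClusterTree.level f σ A A')) A A' ∧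
            ClusterTree.ConnectedInGraph x k α (r (ClusterTree.level f σ A A')) A ∧
            ClusterTree.ConnectedInGraph x k α (r (ClusterTree.level f σ A A')) A' := by
  refine ⟨1600, by norm_num, 20, by norm_num, ?_⟩
  intro d hd 𝒳 f hf δ ε hδ hδ1 hε hε1 n k α hk hα hα2 hkC
  obtain ⟨r, hr, hmass, G, hG, hprob, hrep⟩ := theorem1_general hf hd hδ hδ1.le hε hε1.le hk hkC
  refine ⟨r, hr, hmass, G, hG, hprob, fun x hx A A' σ _ _ hA hA' hσ hgap hsep hn => ?_⟩
  obtain ⟨hdis, hcon⟩ := hrep x hx A A' σ hσ (hsep.level_pos hf hε1) hn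
  exact ⟨hdis α hα2 hgap hsep, (hcon α hα).1 hA.isConnected.isPreconnected,
    (hcon α hα).2 hA'.isConnected.isPreconnected⟩
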